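/- **Setting.** Let $R$ be an integral domain with fraction field $K$, let $A$ be an (associative, unital, not necessarily commutative) $R$-algebra which is finitely generated and free as an $R$-module, and let $\mathfrak p$ be a prime ideal of $R$ with residue field $k(\mathfrak p)=\operatorname{Frac}(R/\mathfrak p)$. For a commutative $R$-algebra $S$ put $A^S=S\otimes_R A$, and put $A(\mathfrak p)=k(\mathfrak p)\otimes_R A$. For a finite-dimensional algebra $E$ over a field let $\mathrm G_0(E)$ be the Grothendieck group of the category of finite-dimensional $E$-modules (it is free abelian on the classes of the simple modules), let $\operatorname{Jac}(E)$ be the Jacobson radical, and say that the $k$-algebra $E$ *splits* if $\operatorname{End}_E(S)=k$ for every simple $E$-module $S$. Let $\mathcal O$ be a local ring with $R\subseteq\mathcal O\subseteq K$, maximal ideal $\mathfrak m$ and residue field $k(\mathfrak m)=\mathcal O/\mathfrak m$, such that $R\cap\mathfrak m=\mathfrak p$; let $A^{\mathcal O}(\mathfrak m)=k(\mathfrak m)\otimes_R A$ and let $\gamma\colon \mathrm G_0(A(\mathfrak p))\to\mathrm G_0(A^{\mathcal O}(\mathfrak m))$, $[M]\mapsto[k(\mathfrak m)\otimes_{k(\mathfrak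 p)}M]$. An *$\mathcal O$-free $A^{\mathcal O}$-form* of a finite-dimensional $A^K$-module $V$ is an $A^{\mathcal O}$-module $W$, free over $\mathcal O$, with $K\otimes_{\mathcal O}W\cong V$ as $A^K$-modules. The ring $\mathcal O$ is an *$A$-gate in $\mathfrak p$* if (i) every finite-dimensional $A^K$-module has an $\mathcal O$-free $A^{\mathcal O}$-form, and (ii) for every finitely generated $\mathcal O$-free $A^{\mathcal O}$-module $W$ the class $[W/\mathfrak mW]\in\mathrm G_0(A^{\mathcal O}(\mathfrak m))$ lies in the image of $\gamma$. **Theorem.** Suppose that $R$ is noetherian and that both $A^K$ and $A(\mathfrak p)$ split. Then for every $A$-gate $\mathcal O$ in $\mathfrak p$ there is a unique group homomorphism (the *decomposition map*) $$d_A^{\mathfrak p,\mathcal O}\colon \mathrm G_0(A^K)\longrightarrow \mathrm G_0(A(\mathfrak p))$$ such that $\gamma\bigl(d_A^{\mathfrak p,\mathcal O}([V])\bigr)=[W/\mathfrak mW]$ for every finite-dimensional $A^K$-module $V$ and every $\mathcal O$-free $A^{\mathcal O}$-form $W$ of $V$. Call $d_A^{\mathfrak p,\mathcal O}$ *trivial*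 if it induces a bijection between the isomorphism classes of simple $A^K$-modules and the isomorphism classes of simple $A(\mathfrak p)$-modules, i.e. if it restricts to a bijection between the classes of simple modules in the two Grothendieck groups. The following are equivalent: 1. $d_A^{\mathfrak p,\mathcal O}$ is trivial for some $A$-gate $\mathcal O$ in $\mathfrak p$; 2. $d_A^{\mathfrak p,\mathcal O}$ is trivial for every $A$-gate $\mathcal O$ in $\mathfrak p$; 3. $\dim_K\operatorname{Jac}(A^K)=\dim_{k(\mathfrak p)}\operatorname{Jac}(A(\mathfrak p))$. -/

import Mathlib

open TensorProduct

universe u v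

namespace Decomposition

section Modules

variable (R : Type u) [CommRing R] (A : Type v) [Ring A] [Algebra R A]

/-- For a commutative `R`-algebra `S`, the modules over the scalar extension `A^S = S ⊗[R] A`
which are finitely generated over `S`, together with their underlying `S`-module structure
(which is determined by the `A^S`-module structure because of the field `tower`).  If `S` is a
field, these are the finite-dimensional `A^S`-modules. -/
structure FinMod (S : Type u) [CommRing S] [Algebra R S] where
  carrier : Type (max u v)
  [addCommGroup : AddCommGroup carrier]
  [moduleBase : Module S carrier]
  [moduleAlg : Module (S ⊗[R] A) carrier]
  [tower : IsScalarTower S (S ⊗[R] A) carrier]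
  [finite : Module.Finite S carrier]

namespace FinMod

instance (S : Type u) [CommRing S] [Algebra R S] :
    CoeSort (FinMod R A S) (Type (max u v)) := ⟨FinMod.carrier⟩

attribute [instance] addCommGroup moduleBase moduleAlg tower finite

variable {R A}

/-- The ring homomorphism through which `A^T = T ⊗[R] A` acts on the scalar extension `T ⊗[S] M`
of an `A^S`-module `M`: it maps `t ⊗ a` to `t' ⊗ m ↦ (t * t') ⊗ (1 ⊗ a) m`. -/
noncomputable def baseChangeAction {S : Type u} [CommRing S] [Algebra R S]
    (T : Type u) [CommRing T] [Algebra R T] [Algebra S T] [IsScalarTower R S T]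
    (M : FinMod R A S) : T ⊗[R] A →ₐ[T] Module.End T (T ⊗[S] M) :=
  Algebra.TensorProduct.lift (Algebra.ofId T (Module.End T (T ⊗[S] M)))
    ((((Module.End.baseChangeHom S T M).comp
      (Algebra.lsmul S S M : S ⊗[R] A →ₐ[S] Module.End S M)).restrictScalars R).comp
        (Algebra.TensorProduct.includeRight : A →ₐ[R] S ⊗[R] A))
    (fun t _ => Algebra.commutes t _)

theorem baseChangeAction_tmul {S : Type u} [CommRing S] [Algebra R S]
    (T : Type u) [CommRing T] [Algebra R T] [Algebra S T] [IsScalarTower R S T]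
    (M : FinMod R A S) (t t' : T) (a : A) (m : M) :
    baseChangeAction T M (t ⊗ₜ[R] a) (t' ⊗ₜ[S] m) =
      (t * t') ⊗ₜ[S] (((1 : S) ⊗ₜ[R] a : S ⊗[R] A) • m) := by
  simp only [baseChangeAction]
  rfl

/-- The scalar extension `M^T = T ⊗[S] M` of an `A^S`-module `M` to an `A^T`-module. -/
noncomputable def baseChange {S : Type u} [CommRing S] [Algebra R S]
    (T : Type u) [CommRing T] [Algebra R T] [Algebra S T] [IsScalarTower R S T]
    (M : FinMod R A S) : FinMod R A T :=
  letI : Module (T ⊗[R] A) (T ⊗[S] M) :=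
    Module.compHom (T ⊗[S] M) (baseChangeAction T M).toRingHom
  { carrier := T ⊗[S] M
    tower := ⟨fun t x m => by
      change baseChangeAction T M (t • x) m = t • baseChangeAction T M x m
      rw [map_smul]; rfl⟩ }

end FinMod

/-- For each short exact sequence `0 → M' → M → M'' → 0` of finite-dimensional `A^k`-modules,
the element `[M] - [M'] - [M'']` of the free abelian group. -/
def shortExactRelations (k : Type u) [Field k] [Algebra R k] :
    Set (FreeAbelianGroup (FinMod R A k)) :=
  {x | ∃ (M' M M'' : FinMod R A k) (f : M' →ₗ[k ⊗[R] A] M) (g : M →ₗ[k ⊗[R] A] M''),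
    Function.Injective f ∧ Function.Exact f g ∧ Function.Surjective g ∧
    x = FreeAbelianGroup.of M - FreeAbelianGroup.of M' - FreeAbelianGroup.of M''}

/-- The Grothendieck group `G₀(A^k)` of the category of finite-dimensional `A^k`-modules,
where `k` is a field which is an `R`-algebra. -/
abbrev G0 (k : Type u) [Field k] [Algebra R k] :=
  FreeAbelianGroup (FinMod R A k) ⧸ AddSubgroup.closure (shortExactRelations R A k)

variable {R A}

/-- The class `[M]` of a finite-dimensional `A^k`-module in the Grothendieck group. -/
def G0.mk {k : Type u} [Field k] [Algebra R k] (M : FinMod R A k) : G0 R A k :=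
  QuotientAddGroup.mk (FreeAbelianGroup.of M)

theorem G0.mk_eq_add {k : Type u} [Field k] [Algebra R k] {M' M M'' : FinMod R A k}
    (f : M' →ₗ[k ⊗[R] A] M) (g : M →ₗ[k ⊗[R] A] M'') (hf : Function.Injective f)
    (hfg : Function.Exact f g) (hg : Function.Surjective g) :
    G0.mk M = G0.mk M' + G0.mk M'' := by
  have h : (QuotientAddGroup.mk (FreeAbelianGroup.of M - FreeAbelianGroup.of M' -
      FreeAbelianGroup.of M'') : G0 R A k) = 0 :=
    (QuotientAddGroup.eq_zero_iff _).2
      (AddSubgroup.subset_closure ⟨M', M, M'', f, g, hf, hfg, hg, rfl⟩)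
  have h' : G0.mk M - G0.mk M' - G0.mk M'' = 0 := h
  rw [sub_sub] at h'
  exact sub_eq_zero.1 h'

/-- The scalar extension of an `A^S`-linear map to an `A^T`-linear map. -/
noncomputable def FinMod.mapBaseChange {S : Type u} [CommRing S] [Algebra R S]
    (T : Type u) [CommRing T] [Algebra R T] [Algebra S T] [IsScalarTower R S T]
    {M N : FinMod R A S} (f : M →ₗ[S ⊗[R] A] N) :
    M.baseChange T →ₗ[T ⊗[R] A] N.baseChange T where
  toFun := ((f.restrictScalars S).baseChange T : T ⊗[S] M →ₗ[T] T ⊗[S] N)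
  map_add' := map_add _
  map_smul' c x := by
    change (f.restrictScalars S).baseChange T (FinMod.baseChangeAction T M c x) =
      FinMod.baseChangeAction T N c ((f.restrictScalars S).baseChange T x)
    induction c with
    | zero =>
      rw [map_zero, map_zero]
      exact map_zero _
    | add c d hc hd =>
      rw [map_add, map_add]
      exact (map_add _ _ _).trans (congrArg₂ _ hc hd)
    | tmul t a =>
      change T ⊗[S] M at x
      induction x with
      | zero => simp
      | add x y hx hy => simp only [map_add, hx, hy]
      | tmul t' m => simp [FinMod.baseChangeAction_tmul]

/-- The homomorphism `G₀(A^k) → G₀(A^l)`, `[M] ↦ [M^l]`, for a field extension `l` of `k`. -/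
noncomputable def G0.baseChange (k l : Type u) [Field k] [Field l] [Algebra R k] [Algebra R l]
    [Algebra k l] [IsScalarTower R k l] : G0 R A k →+ G0 R A l :=
  QuotientAddGroup.lift (AddSubgroup.closure (shortExactRelations R A k))
    (FreeAbelianGroup.lift fun M : FinMod R A k => G0.mk (M.baseChange l)) <| by
      rw [AddSubgroup.closure_le]
      rintro x ⟨M', M, M'', f, g, hf, hfg, hg, rfl⟩
      have key := G0.mk_eq_add (FinMod.mapBaseChange l f) (FinMod.mapBaseChange l g)
        (Module.Flat.lTensor_preserves_injective_linearMap (f.restrictScalars k) hf)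
        (lTensor_exact l (f := f.restrictScalars k) (g := g.restrictScalars k) hfg hg)
        (LinearMap.lTensor_surjective l (g := g.restrictScalars k) hg)
      simp [key]

@[simp]
theorem G0.baseChange_mk (k l : Type u) [Field k] [Field l] [Algebra R k] [Algebra R l]
    [Algebra k l] [IsScalarTower R k l] (M : FinMod R A k) :
    G0.baseChange k l (G0.mk M) = G0.mk (M.baseChange l) := by
  simp [G0.baseChange, G0.mk]

/-- The classes of the simple `A^k`-modules in `G₀(A^k)`.  They form a basis of `G₀(A^k)`, and
non-isomorphic simple modules have different classes, so this set is the set of isomorphism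
classes of simple `A^k`-modules. -/
def simpleClasses (R : Type u) [CommRing R] (A : Type v) [Ring A] [Algebra R A]
    (k : Type u) [Field k] [Algebra R k] : Set (G0 R A k) :=
  {x | ∃ M : FinMod R A k, IsSimpleModule (k ⊗[R] A) M ∧ G0.mk M = x}

end Modules

/-- A finite-dimensional algebra `E` over a field `k` splits: `End_E(M) = k` for every simple
`E`-module `M`. -/
def IsSplitAlgebra (k : Type u) [Field k] (E : Type v) [Ring E] [Algebra k E] : Prop :=
  ∀ (M : Type v) [AddCommGroup M] [Module E M] [IsSimpleModule E M] (f : M →ₗ[E] M),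
    ∃ c : k, ∀ m : M, f m = algebraMap k E c • m

/-- The dimension over `k` of the Jacobson radical of a finite-dimensional `k`-algebra `E`. -/
noncomputable def dimJac (k : Type u) [Field k] (E : Type v) [Ring E] [Algebra k E] : ℕ :=
  Module.finrank k (Ring.jacobson E)

/-- The local rings `𝒪` between `R` and its fraction field `K` whose maximal ideal `𝔪` satisfies
`R ∩ 𝔪 = 𝔭`. -/
structure LocalRingOver (R : Type u) [CommRing R] (K : Type u) [Field K] [Algebra R K]
    (p : Ideal R) where
  ring : Subalgebra R K
  [isLocalRing : IsLocalRing ring]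
  comap_maximalIdeal : (IsLocalRing.maximalIdeal ring).comap (algebraMap R ring) = p

namespace LocalRingOver

attribute [instance] isLocalRing

variable {R : Type u} [CommRing R] {K : Type u} [Field K] [Algebra R K] {p : Ideal R}

/-- The residue field `k(𝔪) = 𝒪/𝔪`. -/
abbrev residueField (O : LocalRingOver R K p) : Type u := IsLocalRing.ResidueField O.ring

theorem algebraMap_residueField_eq_zero_iff (O : LocalRingOver R K p) (r : R) :
    algebraMap R O.residueField r = 0 ↔ r ∈ p := by
  rw [IsScalarTower.algebraMap_apply R O.ring O.residueField,
    IsLocalRing.ResidueField.algebraMap_eq, IsLocalRing.residue_eq_zero_iff]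
  conv_rhs => rw [← O.comap_maximalIdeal]
  rfl

/-- The embedding `k(𝔭) → k(𝔪)` of residue fields. -/
noncomputable instance [p.IsPrime] (O : LocalRingOver R K p) :
    Algebra p.ResidueField O.residueField :=
  (Ideal.ResidueField.lift p (algebraMap R O.residueField)
    (fun r hr => RingHom.mem_ker.2 ((O.algebraMap_residueField_eq_zero_iff r).2 hr))
    (fun r hr => isUnit_iff_ne_zero.2
      (fun h => hr ((O.algebraMap_residueField_eq_zero_iff r).1 h)))).toAlgebra

instance [p.IsPrime] (O : LocalRingOver R K p) :
    IsScalarTower R p.ResidueField O.residueField :=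
  IsScalarTower.of_algebraMap_eq fun r =>
    (Ideal.ResidueField.lift_algebraMap p (algebraMap R O.residueField) _ _ r).symm

variable (A : Type v) [Ring A] [Algebra R A]

variable {A} in
/-- `W` is an `𝒪`-free `A^𝒪`-form of the `A^K`-module `V`: it is free over `𝒪` and `W^K ≅ V`.
Since `V` is finite-dimensional, `W` necessarily has finite rank over `𝒪`. -/
def IsFreeForm (O : LocalRingOver R K p) (W : FinMod R A O.ring) (V : FinMod R A K) : Prop :=
  Module.Free O.ring W ∧ Nonempty (W.baseChange K ≃ₗ[K ⊗[R] A] V)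

variable {A} in
/-- The class in `G₀(A^𝒪(𝔪))` of the reduction `W/𝔪W = k(𝔪) ⊗ W` of an `A^𝒪`-module `W`, where
`A^𝒪(𝔪) = k(𝔪) ⊗[R] A`. -/
noncomputable def reductionClass (O : LocalRingOver R K p) (W : FinMod R A O.ring) :
    G0 R A O.residueField :=
  G0.mk (W.baseChange O.residueField)

/-- The homomorphism `G₀(A(𝔭)) → G₀(A^𝒪(𝔪))` induced by `k(𝔭) → k(𝔪)`. -/
noncomputable def gamma [p.IsPrime] (O : LocalRingOver R K p) :
    G0 R A p.ResidueField →+ G0 R A O.residueField :=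
  G0.baseChange p.ResidueField O.residueField

/-- `𝒪` is a weak `A`-gate in `𝔭`: every finite-dimensional `A^K`-module has an `𝒪`-free
`A^𝒪`-form. -/
def IsWeakGate (O : LocalRingOver R K p) : Prop :=
  ∀ V : FinMod R A K, ∃ W : FinMod R A O.ring, O.IsFreeForm W V

/-- `𝒪` is an `A`-gate in `𝔭`: a weak `A`-gate such that the reductions `W/𝔪W` of all finitely
generated `𝒪`-free `A^𝒪`-modules `W` have their class in the image of `G₀(A(𝔭))`. -/
def IsGate [p.IsPrime] (O : LocalRingOver R K p) : Prop :=
  O.IsWeakGate A ∧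
    ∀ W : FinMod R A O.ring, Module.Free O.ring W → O.reductionClass W ∈ (O.gamma A).range

variable {A} in
/-- The property characterizing the decomposition map of `A` in `𝔭` with respect to the `A`-gate
`𝒪`: the image of `[V]` corresponds, under `G₀(A(𝔭)) → G₀(A^𝒪(𝔪))`, to the class of the
reduction `W/𝔪W` of any `𝒪`-free `A^𝒪`-form `W` of `V`. -/
def IsDecompositionMap [p.IsPrime] (O : LocalRingOver R K p)
    (d : G0 R A K →+ G0 R A p.ResidueField) : Prop :=
  ∀ (V : FinMod R A K) (W : FinMod R A O.ring), O.IsFreeForm W V →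
    O.gamma A (d (G0.mk V)) = O.reductionClass W

open Classical in
/-- The decomposition map `d_A^{𝔭,𝒪} : G₀(A^K) → G₀(A(𝔭))` (the unique homomorphism with the
property `IsDecompositionMap`; it exists if `𝒪` is an `A`-gate). -/
noncomputable def decompositionMap [p.IsPrime] (O : LocalRingOver R K p) :
    G0 R A K →+ G0 R A p.ResidueField :=
  if h : ∃ d, O.IsDecompositionMap (A := A) d then h.choose else 0

/-- The decomposition map `d_A^{𝔭,𝒪}` is trivial: it induces a bijection between the isomorphism
classes of simple `A^K`-modules and those of simple `A(𝔭)`-modules. -/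
def HasTrivialDecompositionMap [p.IsPrime] (O : LocalRingOver R K p) : Prop :=
  Set.BijOn (O.decompositionMap A) (simpleClasses R A K) (simpleClasses R A p.ResidueField)

end LocalRingOver

end Decomposition

/-! Over a split algebra `E`, the density theorem gives a surjection of `E` onto the product of the
matrix algebras `End(S)`, with kernel `Jac(E)`, so `dim E = dim Jac(E) + ∑ (dim S)²`
(`finrank_eq_dimJac_add_sum`). As `A` is free, `A^K` and `A(𝔭)` have the same dimension, and
condition 3 says that the two sums of squares agree. A decomposition map preserves dimension, so a
trivial one forces this equality.

Conversely, let `D` be the matrix of the decomposition map in the bases of simple classes. It has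
nonnegative entries, because splitting of `A(𝔭)` makes `γ` a bijection on simple classes. It has no
zero column, because `[A^K]` goes to `[A(𝔭)]` and every simple module occurs in the regular one.
With dimension vectors `n` and `m` one has `n = D m`; hence `∑ n_i² = ∑ D_ij m_j n_i`, which
dominates `∑ m_j²`, and equality makes `D` a permutation matrix (`exists_bijective_of_sum_sq_eq`).

Classes in `G₀` are compared through the algebraic multiplicity of the eigenvalue 1 of elements of
the algebra (`eq_zero_of_eigenMult_eq_zero`). This integer, unlike a trace, loses nothing in
positive characteristic. It shows that `γ` is injective and, since characteristic polynomials over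
`𝒪` can be compared over `K`, that reductions of forms are well defined and additive. Finally, a
valuation ring dominating `R_𝔭` is a gate (`exists_isGate`), so condition 2 is not vacuous. -/

namespace Decomposition

/-! ### Linear algebra, density, and a lemma on integer matrices -/

/-- The characteristic polynomial is multiplicative in short exact sequences. -/
theorem charpoly_eq_mul_of_exact {k : Type*} [Field k] {M' M M'' : Type*}
    [AddCommGroup M'] [Module k M'] [Module.Finite k M']
    [AddCommGroup M] [Module k M] [Module.Finite k M]
    [AddCommGroup M''] [Module k M''] [Module.Finite k M'']
    (f : M' →ₗ[k] M) (g : M →ₗ[k] M'') (hf : Function.Injective f) (hfg : Function.Exact f g)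
    (hg : Function.Surjective g)
    (e' : M' →ₗ[k] M') (e : M →ₗ[k] M) (e'' : M'' →ₗ[k] M'')
    (h' : ∀ x, f (e' x) = e (f x)) (h'' : ∀ x, g (e x) = e'' (g x)) :
    e.charpoly = e'.charpoly * e''.charpoly := by
  classical
  obtain ⟨l, hl⟩ := g.exists_rightInverse_of_surjective (LinearMap.range_eq_top.2 hg)
  obtain ⟨E, hE1, hE2⟩ := hfg.splitSurjectiveEquiv hf ⟨l, hl⟩
  have hE1 : ∀ x, f x = E.symm (x, 0) := fun x => congrArg (fun h => h x) hE1
  have hE2 : ∀ x, g x = (E x).2 := fun x => congrArg (fun h => h x) hE2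
  let b' := Module.finBasis k M'
  let b'' := Module.finBasis k M''
  let c := (b'.prod b'').map E.symm
  have hc : ∀ x i, c.repr x i = (b'.prod b'').repr (E x) i := fun x i => by simp [c]
  -- In a basis adapted to a splitting over `k`, the matrix of `e` is block upper triangular; the
  -- corner block is irrelevant.
  have key : LinearMap.toMatrix c c e = Matrix.fromBlocks (LinearMap.toMatrix b' b' e')
      (Matrix.of fun i j => LinearMap.toMatrix c c e (Sum.inl i) (Sum.inr j)) 0
      (LinearMap.toMatrix b'' b'' e'') := by
    ext i j
    rcases j with j | j
    · have hj : c (Sum.inl j) = f (b' j) := by simp [c, hE1]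
      rcases i with i | i
      · rw [LinearMap.toMatrix_apply, hc, hj, ← h', hE1]
        simp [LinearMap.toMatrix_apply]
      · rw [LinearMap.toMatrix_apply, hc, hj, ← h', hE1]
        simp
    · have hj : g (c (Sum.inr j)) = b'' j := by simp [c, hE2]
      rcases i with i | i
      · simp
      · simp [LinearMap.toMatrix_apply, hc, ← hE2, h'', hj]
  rw [← LinearMap.charpoly_toMatrix e c, key, Matrix.charpoly_fromBlocks_zero₂₁,
    LinearMap.charpoly_toMatrix, LinearMap.charpoly_toMatrix]

/-- A consequence of the density theorem: an algebra over a field acts on a finite product of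
pairwise non-isomorphic simple modules through all families of linear maps which commute with the
endomorphisms of the factors. -/
theorem exists_smul_eq_of_pairwise_not_iso {k : Type*} [Field k] {E : Type*} [Ring E]
    [Algebra k E] {ι : Type*} [Finite ι] (S : ι → Type*) [∀ i, AddCommGroup (S i)]
    [∀ i, Module k (S i)] [∀ i, Module E (S i)] [∀ i, IsScalarTower k E (S i)]
    [∀ i, Module.Finite k (S i)] [∀ i, IsSimpleModule E (S i)]
    (hS : Pairwise fun i j => IsEmpty (S i ≃ₗ[E] S j))
    (T : ∀ i, S i →ₗ[k] S i) (hT : ∀ i (φ : S i →ₗ[E] S i) x, T i (φ x) = φ (T i x)) :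
    ∃ e : E, ∀ i (x : S i), e • x = T i x := by
  classical
  have := Fintype.ofFinite ι
  -- By Schur's lemma an `E`-endomorphism of the product is diagonal, so the family `T` commutes
  -- with it and lies in the bicommutant.
  have hzero : ∀ (φ : (Π i, S i) →ₗ[E] (Π i, S i)) i j, i ≠ j → ∀ x : S i,
      φ (Pi.single i x) j = 0 := by
    intro φ i j hij x
    have := LinearMap.bijective_or_eq_zero
      ((LinearMap.proj j : (Π i, S i) →ₗ[E] S j) ∘ₗ φ ∘ₗ LinearMap.single E S i)
    rcases this with h | h
    · exact ((hS hij).false (LinearEquiv.ofBijective _ h)).elim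
    · simpa using LinearMap.congr_fun h x
  have hdiag : ∀ (φ : (Π i, S i) →ₗ[E] (Π i, S i)) j (m : Π i, S i),
      φ m j = φ (Pi.single j (m j)) j := by
    intro φ j m
    conv_lhs => rw [← Finset.univ_sum_single m, map_sum, Finset.sum_apply]
    exact Finset.sum_eq_single j (fun i _ hi => hzero φ i j hi _) (by simp)
  let F : Module.End (Module.End E (Π i, S i)) (Π i, S i) :=
    { toFun := fun m i => T i (m i)
      map_add' := fun x y => by ext; simp
      map_smul' := fun φ m => by
        ext j
        simp only [Module.End.smul_def, RingHom.id_apply]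
        rw [hdiag, hdiag φ j fun i => T i (m i)]
        exact hT j ((LinearMap.proj j : (Π i, S i) →ₗ[E] S j) ∘ₗ φ ∘ₗ LinearMap.single E S j)
          (m j) }
  -- Density is applied to a finite `k`-spanning set; agreement there extends by `k`-linearity.
  obtain ⟨s, hs⟩ := Module.Finite.fg_top (R := k) (M := Π i, S i)
  obtain ⟨r, hr⟩ := jacobson_density F s
  have key : (LinearMap.pi fun i => T i ∘ₗ LinearMap.proj i : (Π i, S i) →ₗ[k] Π i, S i) =
      Algebra.lsmul k k (Π i, S i) r :=
    LinearMap.ext_on hs fun m hm => hr m hm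
  refine ⟨r, fun i x => ?_⟩
  have := congrFun (LinearMap.congr_fun key (Pi.single i x)) i
  simpa using this.symm

open Finset in
/-- A matrix `D` of nonnegative integers without zero columns, together with weights `m > 0` whose
images `n = D m` are positive and satisfy `∑ n² = ∑ m²`, is a permutation matrix. -/
theorem exists_bijective_of_sum_sq_eq {ι κ : Type*} [Fintype ι] [Fintype κ] [DecidableEq κ]
    (D : ι → κ → ℤ) (m : κ → ℤ) (n : ι → ℤ) (hD : ∀ i j, 0 ≤ D i j) (hm : ∀ j, 0 < m j)
    (hn : ∀ i, 0 < n i) (hDm : ∀ i, n i = ∑ j, D i j * m j) (hcol : ∀ j, ∃ i, D i j ≠ 0)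
    (hsq : ∑ i, n i ^ 2 = ∑ j, m j ^ 2) :
    ∃ σ : ι → κ, Function.Bijective σ ∧ ∀ i j, D i j = if σ i = j then 1 else 0 := by
  classical
  -- `τ j` is a row with a nonzero entry in column `j`; it turns out to be the inverse permutation.
  choose τ hτ using hcol
  have hτ1 : ∀ j, 1 ≤ D (τ j) j := fun j => by have := hD (τ j) j; have := hτ j; omega
  have hle : ∀ i j, D i j * m j ≤ n i := fun i j => by
    rw [hDm]
    exact single_le_sum (f := fun j => D i j * m j)
      (fun j _ => mul_nonneg (hD i j) (hm j).le) (mem_univ j)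
  have hmn : ∀ j, m j ≤ n (τ j) := fun j => by nlinarith [hle (τ j) j, hτ1 j, hm j]
  have hterm : ∀ i j, 0 ≤ D i j * m j * n i - if τ j = i then m j ^ 2 else 0 := by
    intro i j
    split_ifs with h
    · subst h
      have h1 : m j ≤ D (τ j) j * m j := by nlinarith [hτ1 j, hm j]
      nlinarith [mul_le_mul h1 (hmn j) (hm j).le (by nlinarith [hm j] : 0 ≤ D (τ j) j * m j)]
    · simpa using mul_nonneg (mul_nonneg (hD i j) (hm j).le) (hn i).le
  -- The nonnegative terms add up to `∑ n² - ∑ m² = 0`, so each of them vanishes.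
  have hsum : ∑ i, ∑ j, (D i j * m j * n i - if τ j = i then m j ^ 2 else 0) = 0 := by
    simp only [sum_sub_distrib]
    rw [sub_eq_zero]
    conv_rhs => rw [sum_comm]
    simp only [sum_ite_eq, mem_univ, if_true]
    rw [← hsq]
    refine sum_congr rfl fun i _ => ?_
    rw [← sum_mul, ← hDm, sq]
  have hzero : ∀ i j, D i j * m j * n i - (if τ j = i then m j ^ 2 else 0) = 0 := fun i j =>
    (sum_eq_zero_iff_of_nonneg fun j _ => hterm i j).1
      ((sum_eq_zero_iff_of_nonneg fun i _ => sum_nonneg fun j _ => hterm i j).1 hsum i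
        (mem_univ i)) j (mem_univ j)
  have hne : ∀ i j, τ j ≠ i → D i j = 0 := by
    intro i j h
    have := hzero i j
    rw [if_neg h, sub_zero] at this
    simpa [(hm j).ne', (hn i).ne'] using this
  have heq : ∀ j, D (τ j) j = 1 ∧ m j = n (τ j) := by
    intro j
    have h0 := hzero (τ j) j
    rw [if_pos rfl] at h0
    have h1 : m j * (D (τ j) j * n (τ j) - m j) = 0 := by linarith [h0, sq (m j)]
    have h2 := (mul_eq_zero.1 h1).resolve_left (hm j).ne'
    have h3 : D (τ j) j = 1 := by nlinarith [hτ1 j, hmn j, hm j]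
    rw [h3] at h2
    exact ⟨h3, by linarith⟩
  have hbij : Function.Bijective τ := by
    constructor
    · intro j j' h
      by_contra hjj
      -- Two columns sharing a row would give `m j + m j' ≤ n (τ j) = m j`.
      have h1 : D (τ j) j * m j + D (τ j) j' * m j' ≤ n (τ j) := by
        rw [hDm, ← sum_pair (f := fun l => D (τ j) l * m l) hjj]
        exact sum_le_sum_of_subset_of_nonneg (subset_univ _)
          fun l _ _ => mul_nonneg (hD _ l) (hm l).le
      have h2 := heq j'
      rw [← h] at h2
      rw [(heq j).1, h2.1, ← (heq j).2] at h1
      linarith [hm j']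
    · intro i
      by_contra! h
      have := hn i
      rw [hDm, sum_eq_zero fun j _ => by rw [hne i j (h j), zero_mul]] at this
      exact this.false
  let e := Equiv.ofBijective τ hbij
  refine ⟨e.symm, e.symm.bijective, fun i j => ?_⟩
  split_ifs with h
  · rw [Equiv.symm_apply_eq] at h
    subst h
    exact (heq j).1
  · exact hne i j fun h' => h (by rw [← h']; exact e.symm_apply_apply j)

end Decomposition

/-! ### Additive invariants on the Grothendieck group -/

namespace Decomposition

variable {R : Type u} [CommRing R] {A : Type v} [Ring A] [Algebra R A]

namespace FinMod

variable {S : Type u} [CommRing S] [Algebra R S]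

/-- The regular `A^S`-module. -/
def regular (R : Type u) [CommRing R] (A : Type v) [Ring A] [Algebra R A] [Module.Finite R A]
    (S : Type u) [CommRing S] [Algebra R S] : FinMod R A S where
  carrier := S ⊗[R] A

/-- A quotient of an `A^S`-module. -/
def quotient (M : FinMod R A S) (N : Submodule (S ⊗[R] A) M) : FinMod R A S where
  carrier := M ⧸ N
  finite := Module.Finite.of_surjective (N.mkQ.restrictScalars S) N.mkQ_surjective

/-- A submodule of an `A^S`-module over a noetherian ring. -/
def submodule [IsNoetherianRing S] (M : FinMod R A S) (N : Submodule (S ⊗[R] A) M) :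
    FinMod R A S where
  carrier := N
  finite := Module.Finite.of_injective (N.subtype.restrictScalars S) N.subtype_injective

/-- The action of an element of `A^S` on an `A^S`-module, as an `S`-linear map. -/
def action (M : FinMod R A S) (e : S ⊗[R] A) : M →ₗ[S] M := Algebra.lsmul S S M e

@[simp]
theorem action_apply (M : FinMod R A S) (e : S ⊗[R] A) (m : M) : M.action e m = e • m := rfl

end FinMod

namespace G0

variable {k : Type u} [Field k] [Algebra R k]

/-- An additive function on finite-dimensional modules induces a homomorphism on the Grothendieck
group. -/
def lift {B : Type*} [AddCommGroup B] (φ : FinMod R A k → B)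
    (hφ : ∀ (M' M M'' : FinMod R A k) (f : M' →ₗ[k ⊗[R] A] M) (g : M →ₗ[k ⊗[R] A] M''),
      Function.Injective f → Function.Exact f g → Function.Surjective g → φ M = φ M' + φ M'') :
    G0 R A k →+ B :=
  QuotientAddGroup.lift (AddSubgroup.closure (shortExactRelations R A k))
    (FreeAbelianGroup.lift φ) <| by
      rw [AddSubgroup.closure_le]
      rintro x ⟨M', M, M'', f, g, hf, hfg, hg, rfl⟩
      simp [hφ M' M M'' f g hf hfg hg]

@[simp]
theorem lift_mk {B : Type*} [AddCommGroup B] (φ : FinMod R A k → B) (hφ) (M : FinMod R A k) :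
    lift φ hφ (mk M) = φ M := by
  simp [lift, mk]

theorem hom_ext {B : Type*} [AddCommGroup B] {f g : G0 R A k →+ B}
    (h : ∀ M, f (mk M) = g (mk M)) : f = g := by
  apply QuotientAddGroup.addMonoidHom_ext
  ext M
  exact h M

theorem mk_eq_zero (M : FinMod R A k) [Subsingleton M] : mk M = 0 := by
  -- For a zero module this sequence of identities is exact and gives `[M] = [M] + [M]`.
  have h := mk_eq_add (M' := M) (M := M) (M'' := M) LinearMap.id LinearMap.id
    Function.injective_id (fun x => ⟨fun _ => ⟨x, rfl⟩, fun _ => Subsingleton.elim _ _⟩)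
    Function.surjective_id
  simpa using h

theorem mk_eq_of_equiv {M N : FinMod R A k} (e : M ≃ₗ[k ⊗[R] A] N) : mk M = mk N := by
  have : Subsingleton (M.quotient ⊤) := inferInstanceAs (Subsingleton (M ⧸ (⊤ : Submodule _ M)))
  have h := mk_eq_add (M' := M) (M := N) (M'' := M.quotient ⊤) e.toLinearMap 0 e.injective
    (fun x => ⟨fun _ => e.surjective x, fun _ => rfl⟩)
    (fun x => ⟨0, Subsingleton.elim _ _⟩)
  rw [h, mk_eq_zero (M.quotient ⊤), add_zero]

theorem mk_eq_submodule_add_quotient (M : FinMod R A k) (N : Submodule (k ⊗[R] A) M) :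
    mk M = mk (M.submodule N) + mk (M.quotient N) :=
  mk_eq_add (M' := M.submodule N) (M'' := M.quotient N) N.subtype N.mkQ N.subtype_injective
    (LinearMap.exact_subtype_mkQ N) N.mkQ_surjective

open Polynomial in
/-- The algebraic multiplicity of `1` as an eigenvalue of `e ∈ A^k` on finite-dimensional
modules. -/
noncomputable def eigenMult (e : k ⊗[R] A) : G0 R A k →+ ℤ :=
  lift (fun M => (rootMultiplicity 1 (M.action e).charpoly : ℤ)) <| by
    intro M' M M'' f g hf hfg hg
    have h := charpoly_eq_mul_of_exact (f.restrictScalars k) (g.restrictScalars k) hf hfg hg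
      (M'.action e) (M.action e) (M''.action e) (fun x => f.map_smul e x)
      (fun x => g.map_smul e x)
    rw [h, rootMultiplicity_mul
      (mul_ne_zero (LinearMap.charpoly_monic _).ne_zero (LinearMap.charpoly_monic _).ne_zero)]
    push_cast
    rfl

theorem eigenMult_mk (e : k ⊗[R] A) (M : FinMod R A k) :
    eigenMult e (mk M) = Polynomial.rootMultiplicity 1 (M.action e).charpoly := by
  simp [eigenMult]

theorem eigenMult_eq_finrank {e : k ⊗[R] A} {M : FinMod R A k} (h : ∀ m : M, e • m = m) :
    eigenMult e (mk M) = Module.finrank k M := by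
  have : M.action e = 1 := LinearMap.ext h
  rw [eigenMult_mk, this, LinearMap.charpoly_one, ← map_one Polynomial.C,
    Polynomial.rootMultiplicity_X_sub_C_pow]

theorem eigenMult_eq_zero {e : k ⊗[R] A} {M : FinMod R A k} (h : ∀ m : M, e • m = 0) :
    eigenMult e (mk M) = 0 := by
  have : M.action e = 0 := LinearMap.ext h
  rw [eigenMult_mk, this, LinearMap.charpoly_zero,
    Polynomial.rootMultiplicity_eq_zero (by simp [Polynomial.IsRoot])]
  rfl

/-- The dimension of finite-dimensional modules. -/
noncomputable def dim : G0 R A k →+ ℤ := eigenMult 1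

theorem dim_mk (M : FinMod R A k) : dim (mk M) = Module.finrank k M :=
  eigenMult_eq_finrank fun m => one_smul _ m

/-- Split off a simple submodule and induct on dimension. Using the submonoid rather than the
subgroup is what later yields nonnegative coefficients. -/
theorem mk_mem_closure_simpleClasses (M : FinMod R A k) :
    mk M ∈ AddSubmonoid.closure (simpleClasses R A k) := by
  induction h : Module.finrank k M using Nat.strong_induction_on generalizing M with
  | _ n ih =>
    subst h
    rcases subsingleton_or_nontrivial M with hM | hM
    · rw [mk_eq_zero]
      exact zero_mem _
    · have : IsArtinian (k ⊗[R] A) M := isArtinian_of_tower k inferInstance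
      obtain ⟨N, hN⟩ := IsAtomic.exists_atom (Submodule (k ⊗[R] A) M)
      rw [mk_eq_submodule_add_quotient M N]
      have hNs : IsSimpleModule (k ⊗[R] A) N := isSimpleModule_iff_isAtom.2 hN
      refine add_mem (AddSubmonoid.subset_closure ⟨M.submodule N, hNs, rfl⟩) (ih _ ?_ _ rfl)
      have hdim := congrArg dim (mk_eq_submodule_add_quotient M N)
      rw [map_add, dim_mk, dim_mk, dim_mk] at hdim
      have : Nontrivial (M.submodule N) := IsSimpleModule.nontrivial (k ⊗[R] A) N
      have : 0 < Module.finrank k (M.submodule N) := Module.finrank_pos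
      omega

end G0

end Decomposition

/-! ### Simple classes as a basis, and the radical of a split algebra -/

namespace Decomposition

variable {R : Type u} [CommRing R] {A : Type v} [Ring A] [Algebra R A]

namespace G0

variable {k : Type u} [Field k] [Algebra R k]

/-- Non-isomorphic simple modules have different classes in the Grothendieck group. -/
theorem nonempty_equiv_of_mk_eq {M N : FinMod R A k} (hM : IsSimpleModule (k ⊗[R] A) M)
    (hN : IsSimpleModule (k ⊗[R] A) N) (h : mk M = mk N) : Nonempty (M ≃ₗ[k ⊗[R] A] N) := by
  by_contra hMN
  rw [not_nonempty_iff] at hMN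
  let S : Bool → FinMod R A k := fun b => cond b M N
  have hs : ∀ b, IsSimpleModule (k ⊗[R] A) (S b) := by
    rintro (_ | _)
    exacts [hN, hM]
  obtain ⟨e, he⟩ := exists_smul_eq_of_pairwise_not_iso (k := k) (E := k ⊗[R] A)
    (fun b => S b)
    (by
      rintro (_ | _) (_ | _) hij
      · exact (hij rfl).elim
      · exact ⟨fun φ => hMN.false φ.symm⟩
      · exact hMN
      · exact (hij rfl).elim)
    (fun b => cond b 1 0) (by rintro (_ | _) φ x <;> simp)
  have h1 : eigenMult e (mk M) = _ := eigenMult_eq_finrank fun m => he true m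
  have h2 : eigenMult e (mk N) = 0 := eigenMult_eq_zero fun m => he false m
  have := IsSimpleModule.nontrivial (k ⊗[R] A) M
  have := Module.finrank_pos (R := k) (M := M)
  rw [h, h2] at h1
  omega

/-- A simple module representing a class in `simpleClasses`. -/
noncomputable def simpleRep (x : simpleClasses R A k) : FinMod R A k := x.2.choose

instance (x : simpleClasses R A k) : IsSimpleModule (k ⊗[R] A) (simpleRep x) :=
  x.2.choose_spec.1

@[simp]
theorem mk_simpleRep (x : simpleClasses R A k) : mk (simpleRep x) = x := x.2.choose_spec.2

theorem pairwise_isEmpty_simpleRep_equiv {ι : Type*} {f : ι → simpleClasses R A k}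
    (hf : Function.Injective f) :
    Pairwise fun i j => IsEmpty (simpleRep (f i) ≃ₗ[k ⊗[R] A] simpleRep (f j)) :=
  fun i j hij => ⟨fun φ => hij (hf (Subtype.ext (by
    rw [← mk_simpleRep (f i), ← mk_simpleRep (f j), mk_eq_of_equiv φ])))⟩

/-- Some element of `A^k` acts as the identity on a given simple module and as zero on finitely
many other ones. -/
theorem exists_smul_eq_self_and_eq_zero (s : Finset (simpleClasses R A k))
    (x : simpleClasses R A k) : ∃ e : k ⊗[R] A, (∀ m : simpleRep x, e • m = m) ∧
      ∀ y ∈ s, y ≠ x → ∀ m : simpleRep y, e • m = 0 := by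
  classical
  obtain ⟨e, he⟩ := exists_smul_eq_of_pairwise_not_iso (k := k) (E := k ⊗[R] A)
    (fun y : {y // y ∈ insert x s} => simpleRep y.1)
    (pairwise_isEmpty_simpleRep_equiv Subtype.val_injective)
    (fun y => if y.1 = x then 1 else 0) (by
      intro y φ m
      split_ifs <;> simp)
  refine ⟨e, fun m => ?_, fun y hy hyx m => ?_⟩
  · simpa using he ⟨x, Finset.mem_insert_self _ _⟩ m
  · simpa [hyx] using he ⟨y, Finset.mem_insert_of_mem hy⟩ m

theorem dim_simple_pos (x : simpleClasses R A k) : 0 < dim (x : G0 R A k) := by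
  have := IsSimpleModule.nontrivial (k ⊗[R] A) (simpleRep x)
  rw [← mk_simpleRep, dim_mk]
  exact_mod_cast Module.finrank_pos

/-- The multiplicity of `x` in a linear combination of classes of simple modules can be read off
from some `eigenMult`. -/
theorem exists_eigenMult_sum_eq (s : Finset (simpleClasses R A k))
    (g : simpleClasses R A k → ℤ) {x : simpleClasses R A k} (hx : x ∈ s) :
    ∃ e : k ⊗[R] A, eigenMult e (∑ y ∈ s, g y • (y : G0 R A k)) = g x * dim (x : G0 R A k) := by
  obtain ⟨e, he1, he2⟩ := exists_smul_eq_self_and_eq_zero s x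
  refine ⟨e, ?_⟩
  rw [map_sum, Finset.sum_eq_single x]
  · rw [map_zsmul, smul_eq_mul, ← mk_simpleRep x, eigenMult_eq_finrank he1, dim_mk]
  · intro y hy hyx
    rw [map_zsmul, ← mk_simpleRep y, eigenMult_eq_zero (he2 y hy hyx), smul_zero]
  · exact fun h => (h hx).elim

/-- An element acting as 1 on one simple module and as 0 on the others isolates its coefficient,
multiplied by a positive dimension. -/
theorem linearIndependent_simpleClasses :
    LinearIndependent ℤ (Subtype.val : simpleClasses R A k → G0 R A k) := by
  rw [linearIndependent_iff']
  intro s g hg x hx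
  obtain ⟨e, he⟩ := exists_eigenMult_sum_eq s g hx
  rw [hg, map_zero] at he
  exact (mul_eq_zero.1 he.symm).resolve_right (dim_simple_pos x).ne'

theorem span_simpleClasses : Submodule.span ℤ (simpleClasses R A k) = ⊤ := by
  refine top_le_iff.1 fun x _ => ?_
  have hmk : ∀ M : FinMod R A k, mk M ∈ Submodule.span ℤ (simpleClasses R A k) := fun M =>
    (AddSubmonoid.closure_le (S := (Submodule.span ℤ (simpleClasses R A k)).toAddSubmonoid)).2
      Submodule.subset_span (mk_mem_closure_simpleClasses M)
  have h0 : (QuotientAddGroup.mk' (Submodule.span ℤ (simpleClasses R A k)).toAddSubgroup) = 0 :=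
    hom_ext fun M => (QuotientAddGroup.eq_zero_iff _).2 (hmk M)
  exact (QuotientAddGroup.eq_zero_iff _).1 (DFunLike.congr_fun h0 x)

/-- The basis of the Grothendieck group given by the classes of simple modules. -/
noncomputable def simpleBasis (R : Type u) [CommRing R] (A : Type v) [Ring A] [Algebra R A]
    (k : Type u) [Field k] [Algebra R k] :
    Module.Basis (simpleClasses R A k) ℤ (G0 R A k) :=
  Module.Basis.mk linearIndependent_simpleClasses (by
    rw [Subtype.range_coe, span_simpleClasses])

@[simp]
theorem simpleBasis_apply (x : simpleClasses R A k) : simpleBasis R A k x = x :=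
  Module.Basis.mk_apply _ _ _

/-- A version of the theorem of Brauer and Nesbitt. -/
theorem eq_zero_of_eigenMult_eq_zero {x : G0 R A k} (h : ∀ e : k ⊗[R] A, eigenMult e x = 0) :
    x = 0 := by
  rw [← (simpleBasis R A k).repr.map_eq_zero_iff]
  ext y
  by_contra hy
  obtain ⟨e, he⟩ := exists_eigenMult_sum_eq ((simpleBasis R A k).repr x).support
    ((simpleBasis R A k).repr x) (x := y) (by simpa using hy)
  have hx : ∑ y ∈ ((simpleBasis R A k).repr x).support,
      (simpleBasis R A k).repr x y • (y : G0 R A k) = x := by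
    conv_rhs => rw [← (simpleBasis R A k).linearCombination_repr x,
      Finsupp.linearCombination_apply, Finsupp.sum]
    simp
  rw [hx, h e] at he
  exact (mul_ne_zero hy (dim_simple_pos y).ne') he.symm

theorem repr_nonneg_of_mem_closure {x : G0 R A k}
    (hx : x ∈ AddSubmonoid.closure (simpleClasses R A k)) (y : simpleClasses R A k) :
    0 ≤ (simpleBasis R A k).repr x y := by
  classical
  induction hx using AddSubmonoid.closure_induction with
  | mem x hx =>
    have : x = simpleBasis R A k ⟨x, hx⟩ := by simp
    rw [this, Module.Basis.repr_self, Finsupp.single_apply]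
    split_ifs <;> simp
  | zero => simp
  | add x x' _ _ hx hx' =>
    rw [map_add, Finsupp.add_apply]
    exact add_nonneg hx hx'

variable [Module.Finite R A]

/-- A simple module is a quotient of the regular one, and the kernel contributes nonnegatively. -/
theorem repr_regular_pos (y : simpleClasses R A k) :
    0 < (simpleBasis R A k).repr (mk (FinMod.regular R A k)) y := by
  obtain ⟨m, hm⟩ := @exists_ne _ (IsSimpleModule.nontrivial (k ⊗[R] A) (simpleRep y)) 0
  let π := LinearMap.toSpanSingleton (k ⊗[R] A) (simpleRep y) m
  have hπ : Function.Surjective π := IsSimpleModule.toSpanSingleton_surjective _ hm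
  have h := mk_eq_add (M := FinMod.regular R A k)
    (M' := (FinMod.regular R A k).submodule (LinearMap.ker π)) (M'' := simpleRep y)
    (LinearMap.ker π).subtype π (Submodule.subtype_injective _) (LinearMap.exact_subtype_ker_map π)
    hπ
  have h' := repr_nonneg_of_mem_closure (mk_mem_closure_simpleClasses
    ((FinMod.regular R A k).submodule (LinearMap.ker π))) y
  rw [h, map_add, Finsupp.add_apply, mk_simpleRep, ← simpleBasis_apply y, Module.Basis.repr_self,
    Finsupp.single_eq_same]
  omega

instance : Finite (simpleClasses R A k) := by
  refine Set.finite_univ_iff.1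
    (((simpleBasis R A k).repr (mk (FinMod.regular R A k))).support.finite_toSet.subset ?_)
  intro y _
  simpa using (repr_regular_pos y).ne'

end G0

open G0

variable {k : Type u} [Field k] [Algebra R k]

/-- A simple module over a split algebra is acted on by all linear endomorphisms; this holds
simultaneously for finitely many non-isomorphic simple modules. -/
theorem IsSplitAlgebra.exists_smul_eq (h : IsSplitAlgebra k (k ⊗[R] A)) {ι : Type*} [Finite ι]
    (f : ι → simpleClasses R A k) (hf : Function.Injective f)
    (T : ∀ i, simpleRep (f i) →ₗ[k] simpleRep (f i)) :
    ∃ e : k ⊗[R] A, ∀ i (m : simpleRep (f i)), e • m = T i m := by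
  refine exists_smul_eq_of_pairwise_not_iso (k := k) (fun i => simpleRep (f i))
    (pairwise_isEmpty_simpleRep_equiv hf) T fun i φ m => ?_
  obtain ⟨c, hc⟩ := h (simpleRep (f i)) φ
  rw [hc, hc, algebraMap_smul, algebraMap_smul, map_smul]

theorem smul_eq_zero_of_forall_simpleRep {e : k ⊗[R] A}
    (he : ∀ (x : simpleClasses R A k) (m : simpleRep x), e • m = 0) {M : FinMod R A k}
    (hM : IsSimpleModule (k ⊗[R] A) M) (m : M) : e • m = 0 := by
  have hx : mk M ∈ simpleClasses R A k := ⟨M, hM, rfl⟩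
  obtain ⟨φ⟩ := nonempty_equiv_of_mk_eq hM
    (inferInstance : IsSimpleModule (k ⊗[R] A) (simpleRep ⟨mk M, hx⟩)) (by simp)
  exact φ.injective (by rw [map_smul, he, map_zero])

/-- Wedderburn's count: splitting and density make the action map onto the product of all `End_k(S)`
surjective, and its kernel is the radical. -/
theorem finrank_eq_dimJac_add_sum [Module.Finite R A] [Fintype (simpleClasses R A k)]
    (h : IsSplitAlgebra k (k ⊗[R] A)) :
    (Module.finrank k (k ⊗[R] A) : ℤ) =
      dimJac k (k ⊗[R] A) + ∑ x : simpleClasses R A k, dim (x : G0 R A k) ^ 2 := by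
  let Φ : k ⊗[R] A →ₗ[k] Π x : simpleClasses R A k, simpleRep x →ₗ[k] simpleRep x :=
    LinearMap.pi fun x => (Algebra.lsmul k k (simpleRep x)).toLinearMap
  have hsurj : Function.Surjective Φ := fun T => by
    obtain ⟨e, he⟩ := h.exists_smul_eq id Function.injective_id T
    exact ⟨e, funext fun x => LinearMap.ext fun m => he x m⟩
  have hker : LinearMap.ker Φ = (Ring.jacobson (k ⊗[R] A)).restrictScalars k := by
    ext e
    rw [LinearMap.mem_ker, Submodule.restrictScalars_mem]
    have hΦ : Φ e = 0 ↔ ∀ (x : simpleClasses R A k) (m : simpleRep x), e • m = 0 :=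
      ⟨fun h x m => LinearMap.congr_fun (congrFun h x) m,
        fun h => funext fun x => LinearMap.ext (h x)⟩
    rw [hΦ]
    constructor
    · intro he
      rw [Ring.jacobson_eq_sInf_isMaximal, Submodule.mem_sInf]
      intro I hI
      -- An element annihilating the simple module `A^k / I` kills the class of 1, hence lies in
      -- `I`.
      let N : FinMod R A k := (FinMod.regular R A k).quotient I
      have hN : IsSimpleModule (k ⊗[R] A) N :=
        isSimpleModule_iff_isCoatom.2 (Ideal.isMaximal_def.1 hI)
      have h1 : e • (I.mkQ 1 : N) = 0 := smul_eq_zero_of_forall_simpleRep he hN _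
      have h2 : I.mkQ e = 0 := by
        rw [← h1]
        rw [← map_smul, smul_eq_mul, mul_one]
      simpa using h2
    · intro he x m
      by_cases hm : m = 0
      · rw [hm, smul_zero]
      · have := IsSimpleModule.ker_toSpanSingleton_isMaximal (k ⊗[R] A) hm
        have h1 := Ring.jacobson_le_of_isMaximal
          (LinearMap.ker (LinearMap.toSpanSingleton (k ⊗[R] A) (simpleRep x) m)) he
        simpa using h1
  have h1 := LinearMap.finrank_range_add_finrank_ker Φ
  rw [LinearMap.range_eq_top.2 hsurj, finrank_top, Module.finrank_pi_fintype, hker] at h1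
  rw [← h1, add_comm]
  push_cast
  congr 1
  refine Finset.sum_congr rfl fun x _ => ?_
  rw [Module.finrank_linearMap k k, ← mk_simpleRep x, dim_mk, sq]
  push_cast
  rfl

end Decomposition

/-! ### Scalar extension of modules and of Grothendieck groups -/

namespace Decomposition

variable {R : Type u} [CommRing R] {A : Type v} [Ring A] [Algebra R A]

section ScalarMap

variable (A) (S T : Type u) [CommRing S] [Algebra R S] [CommRing T] [Algebra R T] [Algebra S T]
  [IsScalarTower R S T]

/-- The canonical homomorphism `A^S → A^T`. -/
noncomputable def scalarMap : S ⊗[R] A →ₐ[R] T ⊗[R] A :=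
  Algebra.TensorProduct.map (IsScalarTower.toAlgHom R S T) (AlgHom.id R A)

variable {A} in
@[simp]
theorem scalarMap_tmul (s : S) (a : A) :
    scalarMap A S T (s ⊗ₜ[R] a) = algebraMap S T s ⊗ₜ[R] a := rfl

variable {S T} in
theorem scalarMap_surjective (h : Function.Surjective (algebraMap S T)) :
    Function.Surjective (scalarMap (R := R) A S T) :=
  TensorProduct.map_surjective h Function.surjective_id

variable {S}

namespace FinMod

variable {A} (M : FinMod R A S)

/-- A pure tensor, as an element of the scalar extension of a module. -/
abbrev pureTensor (t : T) (m : M) : M.baseChange T := (t ⊗ₜ[S] m : T ⊗[S] M)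

theorem tmul_smul_tmul (t t' : T) (a : A) (m : M) :
    (t ⊗ₜ[R] a : T ⊗[R] A) • M.pureTensor T t' m =
      M.pureTensor T (t * t') (((1 : S) ⊗ₜ[R] a : S ⊗[R] A) • m) :=
  baseChangeAction_tmul T M t t' a m

theorem scalarMap_smul_tmul (e : S ⊗[R] A) (t : T) (m : M) :
    scalarMap A S T e • M.pureTensor T t m = M.pureTensor T t (e • m) := by
  induction e with
  | zero => rw [map_zero, zero_smul, zero_smul]; exact (tmul_zero _ _).symm
  | add e e' h h' => rw [map_add, add_smul, h, h', add_smul]; exact (tmul_add _ _ _).symm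
  | tmul s a =>
    have h : (s ⊗ₜ[R] a : S ⊗[R] A) • m = s • ((1 : S) ⊗ₜ[R] a : S ⊗[R] A) • m := by
      rw [← smul_assoc, smul_tmul', smul_eq_mul, mul_one]
    rw [scalarMap_tmul, tmul_smul_tmul, h]
    change (algebraMap S T s * t) ⊗ₜ[S] _ = t ⊗ₜ[S] (s • _)
    rw [← Algebra.smul_def]
    exact TensorProduct.smul_tmul s t _

theorem action_scalarMap (e : S ⊗[R] A) :
    (M.baseChange T).action (scalarMap A S T e) = (M.action e).baseChange T := by
  refine LinearMap.ext fun x => ?_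
  change T ⊗[S] M at x
  induction x with
  | zero => exact (map_zero _).trans (map_zero _).symm
  | add x y hx hy => exact (map_add _ _ _).trans ((congrArg₂ _ hx hy).trans (map_add _ _ _).symm)
  | tmul t m => exact scalarMap_smul_tmul T M e t m

theorem charpoly_action_scalarMap [Module.Free S M] [Module.Free T (M.baseChange T)]
    (e : S ⊗[R] A) :
    ((M.baseChange T).action (scalarMap A S T e)).charpoly =
      (M.action e).charpoly.map (algebraMap S T) := by
  rw [action_scalarMap, ← LinearMap.charpoly_baseChange]
  rfl

/-- The scalar extension of the regular module is the regular module. -/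
noncomputable def regularBaseChange [Module.Finite R A] :
    regular R A T ≃ₗ[T ⊗[R] A] (regular R A S).baseChange T :=
  LinearEquiv.ofBijective (LinearMap.toSpanSingleton (T ⊗[R] A) ((regular R A S).baseChange T)
    ((regular R A S).pureTensor T 1 (1 : S ⊗[R] A))) <| by
      let e : T ⊗[R] A ≃ₗ[T] T ⊗[S] (S ⊗[R] A) :=
        (AlgebraTensorModule.cancelBaseChange R S T T A).symm
      have h : ∀ x : T ⊗[R] A, x • (regular R A S).pureTensor T 1 (1 : S ⊗[R] A) = e x := by
        intro x
        induction x with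
        | zero => rw [zero_smul]; exact (map_zero e).symm
        | add x y hx hy => rw [add_smul, hx, hy]; exact (map_add e x y).symm
        | tmul t a =>
          refine (tmul_smul_tmul T (regular R A S) t 1 a (1 : S ⊗[R] A)).trans ?_
          change (t * 1) ⊗ₜ[S] (((1 : S) ⊗ₜ[R] a) * (1 : S ⊗[R] A)) = _
          rw [mul_one, mul_one]
          rfl
      exact (congrArg Function.Bijective (funext h)).mpr e.bijective

end FinMod

end ScalarMap

namespace G0

variable {k : Type u} [Field k] [Algebra R k] (l : Type u) [Field l] [Algebra R l] [Algebra k l]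
  [IsScalarTower R k l]

theorem eigenMult_scalarMap (e : k ⊗[R] A) (x : G0 R A k) :
    eigenMult (scalarMap A k l e) (baseChange k l x) = eigenMult e x := by
  have : (eigenMult (scalarMap A k l e)).comp (baseChange k l) = eigenMult e :=
    hom_ext fun M => by
      rw [AddMonoidHom.comp_apply, baseChange_mk, eigenMult_mk, eigenMult_mk,
        FinMod.charpoly_action_scalarMap,
        Polynomial.eq_rootMultiplicity_map (algebraMap k l).injective, map_one]
  exact DFunLike.congr_fun this x

theorem dim_baseChange (x : G0 R A k) : dim (baseChange k l x) = dim x := by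
  have := eigenMult_scalarMap l (1 : k ⊗[R] A) x
  rwa [map_one] at this

/-- Root multiplicities do not change under field extension, so the invariants over `k` can already
be read off over `l`. -/
theorem baseChange_injective : Function.Injective (baseChange (R := R) (A := A) k l) := by
  rw [injective_iff_map_eq_zero]
  intro x hx
  refine eq_zero_of_eigenMult_eq_zero fun e => ?_
  rw [← eigenMult_scalarMap l, hx, map_zero]

variable [Module.Finite R A]

theorem baseChange_mk_regular :
    baseChange k l (mk (FinMod.regular R A k)) = mk (FinMod.regular R A l) := by
  rw [baseChange_mk]
  exact (mk_eq_of_equiv (FinMod.regularBaseChange l)).symm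

end G0

/-- Matrix units come from `A^k`, hence still act after extension; they move a nonzero coordinate of
any vector to every basis vector. -/
theorem FinMod.isSimpleModule_baseChange {k : Type u} [Field k] [Algebra R k] (l : Type u)
    [Field l] [Algebra R l] [Algebra k l] [IsScalarTower R k l] (M : FinMod R A k) [Nontrivial M]
    (h : ∀ T : M →ₗ[k] M, ∃ e : k ⊗[R] A, ∀ m, e • m = T m) :
    IsSimpleModule (l ⊗[R] A) (M.baseChange l) := by
  classical
  have hnt : Nontrivial (M.baseChange l) := by
    apply Module.nontrivial_of_finrank_pos (R := l)
    change 0 < Module.finrank l (l ⊗[k] M)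
    rw [Module.finrank_baseChange]
    exact Module.finrank_pos
  rw [isSimpleModule_iff_toSpanSingleton_surjective]
  refine ⟨hnt, fun v hv w => ?_⟩
  let b := Module.finBasis k M
  let b' : Module.Basis _ l (M.baseChange l) := Algebra.TensorProduct.basis l b
  have hb' : ∀ i, b' i = M.pureTensor l 1 (b i) := fun i => Algebra.TensorProduct.basis_apply b i
  obtain ⟨j, hj⟩ : ∃ j, b'.repr v j ≠ 0 := by
    by_contra! h0
    exact hv (b'.repr.map_eq_zero_iff.1 (Finsupp.ext h0))
  choose e he using fun i => h ((b.coord j).smulRight (b i))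
  have hact : ∀ i (x : M.baseChange l), scalarMap A k l (e i) • x = b'.repr x j • b' i := by
    intro i x
    have h1 : (M.baseChange l).action (scalarMap A k l (e i)) =
        (b'.coord j).smulRight (b' i) := by
      refine b'.ext fun i' => ?_
      rw [FinMod.action_apply, hb', FinMod.scalarMap_smul_tmul, he, LinearMap.smulRight_apply,
        LinearMap.smulRight_apply, ← hb']
      rw [Module.Basis.coord_apply, Module.Basis.coord_apply, Module.Basis.repr_self,
        Module.Basis.repr_self, Finsupp.single_apply, Finsupp.single_apply]
      split_ifs
      · rw [one_smul, one_smul, hb']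
      · rw [zero_smul, zero_smul]
        exact tmul_zero _ _
    exact LinearMap.congr_fun h1 x
  refine ⟨∑ i, (b'.repr w i * (b'.repr v j)⁻¹) • scalarMap A k l (e i), ?_⟩
  rw [LinearMap.toSpanSingleton_apply, Finset.sum_smul]
  conv_rhs => rw [← b'.sum_repr w]
  refine Finset.sum_congr rfl fun i _ => ?_
  rw [smul_assoc, hact, smul_smul, mul_assoc, inv_mul_cancel₀ hj, mul_one]

open G0

/-- Splitting keeps simple modules simple. No new ones appear: each simple `A^l`-module occurs in
the regular one, whose class is a combination of extended simple classes. -/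
theorem image_baseChange_simpleClasses [Module.Finite R A] {k : Type u} [Field k] [Algebra R k]
    (h : IsSplitAlgebra k (k ⊗[R] A)) (l : Type u) [Field l] [Algebra R l] [Algebra k l]
    [IsScalarTower R k l] :
    G0.baseChange k l '' simpleClasses R A k = simpleClasses R A l := by
  have hsub : G0.baseChange k l '' simpleClasses R A k ⊆ simpleClasses R A l := by
    rintro _ ⟨x, hx, rfl⟩
    refine ⟨(simpleRep ⟨x, hx⟩).baseChange l, ?_, by rw [← baseChange_mk, mk_simpleRep]⟩
    have := IsSimpleModule.nontrivial (k ⊗[R] A) (simpleRep ⟨x, hx⟩)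
    refine FinMod.isSimpleModule_baseChange l _ fun T => ?_
    obtain ⟨e, he⟩ := h.exists_smul_eq (fun _ : Unit => (⟨x, hx⟩ : simpleClasses R A k))
      (Function.injective_of_subsingleton _) fun _ => T
    exact ⟨e, he ()⟩
  refine hsub.antisymm fun y hy => ?_
  let s : Set (simpleClasses R A l) := Subtype.val ⁻¹' (G0.baseChange k l '' simpleClasses R A k)
  have hs : simpleBasis R A l '' s = G0.baseChange k l '' simpleClasses R A k := by
    ext z
    simp only [Set.mem_image, simpleBasis_apply]
    exact ⟨fun ⟨z', hz, h⟩ => h ▸ hz, fun hz => ⟨⟨z, hsub hz⟩, hz, rfl⟩⟩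
  have hreg : mk (FinMod.regular R A l) ∈ Submodule.span ℤ (simpleBasis R A l '' s) := by
    rw [← baseChange_mk_regular (k := k) l, hs]
    have h1 : mk (FinMod.regular R A k) ∈ Submodule.span ℤ (simpleClasses R A k) := by
      rw [span_simpleClasses]; trivial
    have h2 := Submodule.mem_map_of_mem (f := (G0.baseChange k l).toIntLinearMap) h1
    rwa [Submodule.map_span] at h2
  rw [Module.Basis.mem_span_image] at hreg
  exact hreg (a := ⟨y, hy⟩) (by simpa using (repr_regular_pos ⟨y, hy⟩).ne')

end Decomposition

/-! ### Reduction of free forms and the decomposition map -/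

namespace Decomposition

variable {R : Type u} [CommRing R] {A : Type v} [Ring A] [Algebra R A]

open G0

namespace LocalRingOver

variable {K : Type u} [Field K] [Algebra R K] {p : Ideal R} {O : LocalRingOver R K p}

theorem IsFreeForm.charpoly_map {W : FinMod R A O.ring} {V : FinMod R A K}
    (h : O.IsFreeForm W V) [Module.Free O.ring W] (a : O.ring ⊗[R] A) :
    (W.action a).charpoly.map (algebraMap O.ring K) =
      (V.action (scalarMap A O.ring K a)).charpoly := by
  obtain ⟨-, ⟨φ⟩⟩ := h
  rw [← FinMod.charpoly_action_scalarMap, ← LinearEquiv.charpoly_conj (φ.restrictScalars K)]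
  congr 1
  refine LinearMap.ext fun v => ?_
  rw [LinearEquiv.conj_apply_apply]
  exact (φ.map_smul _ _).trans (congrArg _ (φ.apply_symm_apply v))

theorem eigenMult_reductionClass (W : FinMod R A O.ring) [Module.Free O.ring W]
    (a : O.ring ⊗[R] A) :
    eigenMult (scalarMap A O.ring O.residueField a) (O.reductionClass W) =
      ((W.action a).charpoly.map (algebraMap O.ring O.residueField)).rootMultiplicity 1 := by
  rw [reductionClass, eigenMult_mk, FinMod.charpoly_action_scalarMap]

/-- Elements of `A^𝒪` suffice as tests, since they surject onto `A^𝒪(𝔪)`. -/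
theorem eq_of_forall_eigenMult_scalarMap {x y : G0 R A O.residueField}
    (h : ∀ a : O.ring ⊗[R] A, eigenMult (scalarMap A O.ring O.residueField a) x =
      eigenMult (scalarMap A O.ring O.residueField a) y) : x = y := by
  rw [← sub_eq_zero]
  refine eq_zero_of_eigenMult_eq_zero fun e => ?_
  obtain ⟨a, rfl⟩ := scalarMap_surjective (A := A) (R := R) (S := O.ring) (T := O.residueField)
    IsLocalRing.residue_surjective e
  rw [map_sub, h, sub_self]

theorem map_algebraMap_injective :
    Function.Injective (Polynomial.map (algebraMap O.ring K)) :=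
  Polynomial.map_injective _ Subtype.val_injective

/-- The class of the reduction does not depend on the free form. -/
theorem IsFreeForm.reductionClass_eq {W W' : FinMod R A O.ring} {V : FinMod R A K}
    (h : O.IsFreeForm W V) (h' : O.IsFreeForm W' V) : O.reductionClass W = O.reductionClass W' := by
  have := h.1
  have := h'.1
  refine eq_of_forall_eigenMult_scalarMap fun a => ?_
  have : (W.action a).charpoly = (W'.action a).charpoly :=
    map_algebraMap_injective (by rw [h.charpoly_map, h'.charpoly_map])
  rw [eigenMult_reductionClass, eigenMult_reductionClass, this]

/-- The class of the reduction of a free form is additive in short exact sequences. -/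
theorem IsFreeForm.reductionClass_eq_add {W' W W'' : FinMod R A O.ring}
    {V' V V'' : FinMod R A K} (h' : O.IsFreeForm W' V') (h : O.IsFreeForm W V)
    (h'' : O.IsFreeForm W'' V'') (f : V' →ₗ[K ⊗[R] A] V) (g : V →ₗ[K ⊗[R] A] V'')
    (hf : Function.Injective f) (hfg : Function.Exact f g) (hg : Function.Surjective g) :
    O.reductionClass W = O.reductionClass W' + O.reductionClass W'' := by
  have := h.1
  have := h'.1
  have := h''.1
  refine eq_of_forall_eigenMult_scalarMap fun a => ?_
  -- The three forms need not fit into an exact sequence; only their characteristic polynomials are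
  -- compared, over `K`.
  have : (W.action a).charpoly = (W'.action a).charpoly * (W''.action a).charpoly := by
    apply map_algebraMap_injective
    rw [Polynomial.map_mul, h.charpoly_map, h'.charpoly_map, h''.charpoly_map]
    exact charpoly_eq_mul_of_exact (f.restrictScalars K) (g.restrictScalars K) hf hfg hg _ _ _
      (fun x => f.map_smul _ x) (fun x => g.map_smul _ x)
  rw [map_add, eigenMult_reductionClass, eigenMult_reductionClass, eigenMult_reductionClass, this,
    Polynomial.map_mul, Polynomial.rootMultiplicity_mul
      (mul_ne_zero ((LinearMap.charpoly_monic _).map _).ne_zero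
        ((LinearMap.charpoly_monic _).map _).ne_zero)]
  push_cast
  rfl

variable [p.IsPrime]

theorem gamma_injective : Function.Injective (O.gamma A) := baseChange_injective _

/-- Reduction of chosen forms is additive with values in the image of the injective `γ`, so it
factors uniquely through `γ`. -/
theorem IsGate.existsUnique (hO : O.IsGate A) :
    ∃! d : G0 R A K →+ G0 R A p.ResidueField, O.IsDecompositionMap d := by
  choose W hW using hO.1
  let D : G0 R A K →+ G0 R A O.residueField := G0.lift (fun V => O.reductionClass (W V))
    fun V' V V'' => (hW V').reductionClass_eq_add (hW V) (hW V'')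
  have hD : ∀ x, ∃ y, O.gamma A y = D x := by
    have h0 : (QuotientAddGroup.mk' (O.gamma A).range).comp D = 0 :=
      hom_ext fun V => (QuotientAddGroup.eq_zero_iff _).2 (by
        rw [G0.lift_mk]
        exact hO.2 (W V) (hW V).1)
    exact fun x => (QuotientAddGroup.eq_zero_iff _).1 (DFunLike.congr_fun h0 x)
  choose d hd using hD
  refine ⟨AddMonoidHom.mk' d fun x y => gamma_injective (O := O) (by
    rw [map_add, hd, hd, hd, map_add]), ?_, ?_⟩
  · intro V U hU
    rw [AddMonoidHom.mk'_apply, hd, G0.lift_mk]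
    exact (hW V).reductionClass_eq hU
  · intro d' hd'
    refine hom_ext fun V => gamma_injective (O := O) ?_
    rw [AddMonoidHom.mk'_apply, hd, G0.lift_mk]
    exact hd' V (W V) (hW V)

theorem IsGate.isDecompositionMap (hO : O.IsGate A) :
    O.IsDecompositionMap (O.decompositionMap A) := by
  have h := hO.existsUnique.exists
  rw [decompositionMap, dif_pos h]
  exact h.choose_spec

/-- On `[V]` both sides are the `𝒪`-rank of a free form of `V`. -/
theorem IsGate.dim_decompositionMap (hO : O.IsGate A) (x : G0 R A K) :
    dim (O.decompositionMap A x) = dim x := by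
  suffices h : dim.comp (O.decompositionMap A) = dim from DFunLike.congr_fun h x
  refine hom_ext fun V => ?_
  obtain ⟨W, hW⟩ := hO.1 V
  have := hW.1
  obtain ⟨φ⟩ := hW.2
  rw [AddMonoidHom.comp_apply, ← dim_baseChange O.residueField, ← mk_eq_of_equiv φ]
  have h := hO.isDecompositionMap V W hW
  rw [← mk_eq_of_equiv φ] at h
  refine (congrArg dim h).trans ?_
  rw [reductionClass, dim_mk, dim_mk]
  change (Module.finrank O.residueField (O.residueField ⊗[O.ring] W) : ℤ) =
    Module.finrank K (K ⊗[O.ring] W)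
  rw [Module.finrank_baseChange, Module.finrank_baseChange]

variable [Module.Finite R A]

/-- Simple classes over `k(𝔪)` all come from simple classes over `k(𝔭)`. This serves both the
nonnegativity of decomposition numbers and the second gate condition. -/
theorem mem_closure_of_gamma_eq_mk
    (hp : IsSplitAlgebra p.ResidueField (p.ResidueField ⊗[R] A)) (M : FinMod R A O.residueField) :
    ∃ x ∈ AddSubmonoid.closure (simpleClasses R A p.ResidueField), O.gamma A x = G0.mk M := by
  have h := mk_mem_closure_simpleClasses M
  rw [← image_baseChange_simpleClasses hp, ← AddMonoidHom.map_mclosure] at h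
  exact h

theorem IsGate.repr_decompositionMap_nonneg (hO : O.IsGate A)
    (hp : IsSplitAlgebra p.ResidueField (p.ResidueField ⊗[R] A)) (V : FinMod R A K)
    (y : simpleClasses R A p.ResidueField) :
    0 ≤ (simpleBasis R A p.ResidueField).repr (O.decompositionMap A (G0.mk V)) y := by
  obtain ⟨W, hW⟩ := hO.1 V
  obtain ⟨x, hx, hxW⟩ := mem_closure_of_gamma_eq_mk hp (W.baseChange O.residueField)
  have : O.decompositionMap A (G0.mk V) = x :=
    gamma_injective ((hO.isDecompositionMap V W hW).trans hxW.symm)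
  rw [this]
  exact repr_nonneg_of_mem_closure hx y

/-- Freeness of `A` makes `A^𝒪` itself a free form of `A^K`. -/
theorem IsGate.decompositionMap_regular [Module.Free R A] (hO : O.IsGate A) :
    O.decompositionMap A (G0.mk (FinMod.regular R A K)) =
      G0.mk (FinMod.regular R A p.ResidueField) := by
  apply gamma_injective (O := O)
  have hfree : O.IsFreeForm (FinMod.regular R A O.ring) (FinMod.regular R A K) :=
    ⟨inferInstanceAs (Module.Free O.ring (O.ring ⊗[R] A)),
      ⟨(FinMod.regularBaseChange K).symm⟩⟩
  rw [hO.isDecompositionMap _ _ hfree, gamma, baseChange_mk_regular, reductionClass]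
  exact (mk_eq_of_equiv (FinMod.regularBaseChange _)).symm

end LocalRingOver

end Decomposition

/-! ### Existence of gates: valuation rings -/

namespace Decomposition

/-- A subalgebra of a field which contains every element or its inverse is a valuation ring. -/
theorem valuationRing_of_mem_or_inv_mem {R K : Type*} [CommRing R] [Field K] [Algebra R K]
    (S : Subalgebra R K) (h : ∀ x, x ∈ S ∨ x⁻¹ ∈ S) : ValuationRing S where
  cond' a b := by
    by_cases hb : b = 0
    · exact ⟨0, Or.inl (by rw [hb, mul_zero])⟩
    by_cases ha : a = 0
    · exact ⟨0, Or.inr (by rw [ha, mul_zero])⟩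
    have ha : (a : K) ≠ 0 := by simpa using ha
    have hb : (b : K) ≠ 0 := by simpa using hb
    rcases h (b / a) with h | h
    · exact ⟨⟨_, h⟩, Or.inl (Subtype.ext (mul_div_cancel₀ _ ha))⟩
    · rw [inv_div] at h
      exact ⟨⟨_, h⟩, Or.inr (Subtype.ext (mul_div_cancel₀ _ hb))⟩

/-- Every prime ideal of a domain is dominated by a valuation ring of the fraction field. -/
theorem LocalRingOver.exists_valuationRing {R : Type u} [CommRing R] [IsDomain R] {K : Type u}
    [Field K] [Algebra R K] [IsFractionRing R K] (p : Ideal R) [p.IsPrime] :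
    ∃ O : LocalRingOver R K p, ValuationRing O.ring := by
  have hunit : ∀ y : p.primeCompl, IsUnit (algebraMap R K y) := fun y =>
    isUnit_iff_ne_zero.2 fun h => y.2 (by
      rw [(IsFractionRing.injective R K) (h.trans (map_zero _).symm)]
      exact p.zero_mem)
  let f : Localization.AtPrime p →+* K := IsLocalization.lift (M := p.primeCompl) hunit
  obtain ⟨V, hV, hloc⟩ := IsLocalRing.exists_factor_valuationRing f
  have hf : ∀ r, f (algebraMap R _ r) = algebraMap R K r := IsLocalization.lift_eq hunit
  let S : Subalgebra R K :=
    { V.toSubring with algebraMap_mem' := fun r => hf r ▸ hV (algebraMap R _ r) }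
  have hS : ValuationRing S := valuationRing_of_mem_or_inv_mem S V.mem_or_inv_mem'
  refine ⟨⟨S, ?_⟩, hS⟩
  ext r
  rw [Ideal.mem_comap, IsLocalRing.mem_maximalIdeal, mem_nonunits_iff,
    ← IsLocalization.AtPrime.to_map_mem_maximal_iff (Localization.AtPrime p) p r,
    IsLocalRing.mem_maximalIdeal, mem_nonunits_iff, not_iff_not]
  -- Domination, i.e. locality of `R_𝔭 → V`, identifies the contraction of the maximal ideal with
  -- `p`.
  have h1 : IsUnit (f.codRestrict V.toSubring hV (algebraMap R _ r)) ↔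
      IsUnit (algebraMap R (Localization.AtPrime p) r) := isUnit_map_iff _ _
  rw [← h1]
  have h2 : (f.codRestrict V.toSubring hV (algebraMap R _ r) : K) = algebraMap R K r := hf r
  have aux : ∀ (x : S) (y : V.toSubring), (x : K) = y → IsUnit x → IsUnit y := by
    intro x y hxy hx
    obtain ⟨z, hz⟩ := isUnit_iff_exists_inv.1 hx
    exact isUnit_iff_exists_inv.2 ⟨⟨z, z.2⟩, Subtype.ext (by
      rw [Subring.coe_mul, ← hxy]; exact congrArg Subtype.val hz)⟩
  have aux' : ∀ (x : S) (y : V.toSubring), (x : K) = y → IsUnit y → IsUnit x := by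
    intro x y hxy hy
    obtain ⟨z, hz⟩ := isUnit_iff_exists_inv.1 hy
    exact isUnit_iff_exists_inv.2 ⟨⟨z, z.2⟩, Subtype.ext (by
      rw [Subalgebra.coe_mul, hxy]; exact congrArg Subtype.val hz)⟩
  exact ⟨aux _ _ h2.symm, aux' _ _ h2.symm⟩

variable {R : Type u} [CommRing R] {A : Type v} [Ring A] [Algebra R A]

theorem scalarMap_smul {S T : Type u} [CommRing S] [Algebra R S] [CommRing T] [Algebra R T]
    [Algebra S T] [IsScalarTower R S T] (s : S) (e : S ⊗[R] A) :
    scalarMap A S T (s • e) = algebraMap S T s • scalarMap A S T e := by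
  induction e with
  | zero => rw [smul_zero, map_zero, smul_zero]
  | add e e' h h' => rw [smul_add, map_add, h, h', map_add, smul_add]
  | tmul s' a => rw [smul_tmul', scalarMap_tmul, scalarMap_tmul, smul_tmul', smul_eq_mul,
      smul_eq_mul, map_mul]

theorem isFractionRing_subalgebra {R K : Type*} [CommRing R] [IsDomain R] [Field K] [Algebra R K]
    [IsFractionRing R K] (S : Subalgebra R K) : IsFractionRing S K := by
  refine IsFractionRing.of_field S K fun z => ?_
  obtain ⟨x, y, -, rfl⟩ := IsFractionRing.div_surjective (A := R) z
  exact ⟨algebraMap R S x, algebraMap R S y, rfl⟩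

/-- A valuation ring is Bézout, so torsion-free means flat, and finite flat modules over a local
ring are free. -/
theorem free_of_isTorsionFree_of_valuationRing (S M : Type*) [CommRing S] [IsDomain S]
    [ValuationRing S] [AddCommGroup M] [Module S M] [Module.Finite S M] [Module.IsTorsionFree S M] :
    Module.Free S M := by
  have : Module.Flat S M := Module.Flat.flat_iff_torsion_eq_bot_of_isBezout.2
    (Submodule.isTorsionFree_iff_torsion_eq_bot.1 inferInstance)
  exact Module.free_of_flat_of_isLocalRing

/-- Surjectivity is the spanning hypothesis. Injectivity is a dimension count: independence over `S`
in `V` persists over `K`. -/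
theorem liftBaseChange_bijective {S K N V : Type*} [CommRing S] [IsDomain S] [Field K] [Algebra S K]
    [IsFractionRing S K] [AddCommGroup N] [Module S N] [Module.Finite S N] [Module.Free S N]
    [AddCommGroup V] [Module K V] [Module S V] [IsScalarTower S K V] [Module.Finite K V]
    (ι : N →ₗ[S] V) (hι : Function.Injective ι)
    (hspan : Submodule.span K (Set.range ι) = ⊤) :
    Function.Bijective (ι.liftBaseChange K) := by
  have hsurj : Function.Surjective (ι.liftBaseChange K) := by
    rw [← LinearMap.range_eq_top, ← top_le_iff, ← hspan, Submodule.span_le]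
    rintro _ ⟨n, rfl⟩
    exact ⟨1 ⊗ₜ n, by simp⟩
  have hle : Module.finrank K (K ⊗[S] N) ≤ Module.finrank K V := by
    rw [Module.finrank_baseChange, Module.finrank_eq_card_basis (Module.finBasis S N)]
    have h1 : LinearIndependent S (ι ∘ Module.finBasis S N) :=
      (Module.finBasis S N).linearIndependent.map' ι (LinearMap.ker_eq_bot.2 hι)
    exact ((LinearIndependent.iff_fractionRing S K).1 h1).fintype_card_le_finrank
  exact ⟨(LinearMap.injective_iff_surjective_of_finrank_eq_finrank
    (hle.antisymm (LinearMap.finrank_le_finrank_of_surjective hsurj))).2 hsurj, hsurj⟩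

/-- An `S`-linear map `W → V` from an `A^S`-module to an `A^T`-module which is compatible with the
actions of `A^S` extends to an `A^T`-linear map on `W^T`. -/
noncomputable def FinMod.liftBaseChange {S T : Type u} [CommRing S] [Algebra R S] [CommRing T]
    [Algebra R T] [Algebra S T] [IsScalarTower R S T] {W : FinMod R A S} {V : FinMod R A T}
    [Module S V] [IsScalarTower S T V] (ι : W →ₗ[S] V)
    (hι : ∀ (e : S ⊗[R] A) w, ι (e • w) = scalarMap A S T e • ι w) :
    W.baseChange T →ₗ[T ⊗[R] A] V where
  toFun := (ι.liftBaseChange T : T ⊗[S] W →ₗ[T] V)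
  map_add' := map_add _
  map_smul' c x := by
    let f : W.baseChange T →ₗ[T] V := ι.liftBaseChange T
    have hf : ∀ (t : T) (w : W), f (W.pureTensor T t w) = t • ι w :=
      fun t w => LinearMap.liftBaseChange_tmul T ι t w
    change f (c • x) = c • f x
    induction c with
    | zero => rw [zero_smul, zero_smul, map_zero]
    | add c c' h h' => rw [add_smul, add_smul, map_add, h, h']
    | tmul t a =>
      change f.comp ((W.baseChange T).action (t ⊗ₜ[R] a)) x =
        (V.action (t ⊗ₜ[R] a)).comp f x
      congr 1
      refine TensorProduct.AlgebraTensorModule.ext (M := T) (N := W) fun t' w => ?_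
      change f ((t ⊗ₜ[R] a : T ⊗[R] A) • W.pureTensor T t' w) =
        V.action (t ⊗ₜ[R] a) (f (W.pureTensor T t' w))
      rw [tmul_smul_tmul, hf, hf, hι, map_smul, action_apply, scalarMap_tmul, map_one, mul_comm,
        mul_smul, ← smul_assoc t, smul_tmul', smul_eq_mul, mul_one]

theorem LocalRingOver.isFreeForm_of_injective [IsDomain R] {K : Type u} [Field K] [Algebra R K]
    [IsFractionRing R K] {p : Ideal R} {O : LocalRingOver R K p} {W : FinMod R A O.ring}
    [Module.Free O.ring W] {V : FinMod R A K} (ι : W →ₗ[O.ring] V)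
    (hι : ∀ (e : O.ring ⊗[R] A) w, ι (e • w) = scalarMap A O.ring K e • ι w)
    (hinj : Function.Injective ι) (hspan : Submodule.span K (Set.range ι) = ⊤) :
    O.IsFreeForm W V :=
  have : IsFractionRing O.ring K := isFractionRing_subalgebra O.ring
  ⟨inferInstance, ⟨LinearEquiv.ofBijective (FinMod.liftBaseChange ι hι)
    (liftBaseChange_bijective ι hinj hspan)⟩⟩

/-- Over a valuation ring, the submodule generated by a basis of an `A^K`-module is a free
form. -/
theorem LocalRingOver.isWeakGate_of_valuationRing [IsDomain R] [Module.Finite R A] {K : Type u}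
    [Field K] [Algebra R K] [IsFractionRing R K] {p : Ideal R} (O : LocalRingOver R K p)
    [ValuationRing O.ring] : O.IsWeakGate A := by
  intro V
  let : Module (O.ring ⊗[R] A) V := Module.compHom V (scalarMap A O.ring K).toRingHom
  have hsmul : ∀ (e : O.ring ⊗[R] A) (v : V), e • v = scalarMap A O.ring K e • v :=
    fun _ _ => rfl
  have : IsScalarTower O.ring (O.ring ⊗[R] A) V := ⟨fun a e v => by
    rw [hsmul, hsmul, scalarMap_smul, smul_assoc]
    rfl⟩
  let b := Module.finBasis K V
  -- This lattice is finite over `𝒪` because `A^𝒪` is, and torsion-free as a subset of `V`.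
  let N : Submodule (O.ring ⊗[R] A) V := Submodule.span _ (Set.range b)
  have : Module.Finite (O.ring ⊗[R] A) N := Module.Finite.span_of_finite _ (Set.finite_range b)
  have : Module.Finite O.ring N := Module.Finite.trans (O.ring ⊗[R] A) N
  have : Module.IsTorsionFree O.ring V := .trans_faithfulSMul O.ring K V
  have : Module.IsTorsionFree O.ring N :=
    N.subtype_injective.moduleIsTorsionFree _ fun _ _ => rfl
  have : Module.Free O.ring N := free_of_isTorsionFree_of_valuationRing O.ring N
  let W : FinMod R A O.ring := { carrier := N }
  have : Module.Free O.ring W := ‹Module.Free O.ring N›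
  let ι : W →ₗ[O.ring] V := N.subtype.restrictScalars O.ring
  have hspan : Submodule.span K (Set.range ι) = ⊤ := by
    rw [← top_le_iff, ← b.span_eq, Submodule.span_le]
    rintro _ ⟨i, rfl⟩
    exact Submodule.subset_span ⟨⟨b i, Submodule.subset_span ⟨i, rfl⟩⟩, rfl⟩
  exact ⟨W, isFreeForm_of_injective ι (fun _ _ => rfl) N.subtype_injective hspan⟩

/-- For a dominating valuation ring lattices provide the forms; splitting of `A(𝔭)` puts every
module class in the image of `γ`. -/
theorem LocalRingOver.exists_isGate [IsDomain R] [Module.Finite R A] {K : Type u}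
    [Field K] [Algebra R K] [IsFractionRing R K] (p : Ideal R) [p.IsPrime]
    (hp : IsSplitAlgebra p.ResidueField (p.ResidueField ⊗[R] A)) :
    ∃ O : LocalRingOver R K p, O.IsGate A := by
  obtain ⟨O, hO⟩ := LocalRingOver.exists_valuationRing (K := K) p
  refine ⟨O, O.isWeakGate_of_valuationRing, fun W _ => ?_⟩
  obtain ⟨x, -, hx⟩ := mem_closure_of_gamma_eq_mk hp (W.baseChange O.residueField)
  exact ⟨x, hx⟩

end Decomposition

/-! ### Triviality and the dimension of the radical -/

namespace Decomposition

open G0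

namespace LocalRingOver

variable {R : Type u} [CommRing R] [IsDomain R] {K : Type u} [Field K] [Algebra R K]
  {A : Type v} [Ring A] [Algebra R A] [Module.Finite R A] [Module.Free R A]
  {p : Ideal R} [p.IsPrime] {O : LocalRingOver R K p}

theorem dimJac_eq_iff_sum_sq_eq (hK : IsSplitAlgebra K (K ⊗[R] A))
    (hp : IsSplitAlgebra p.ResidueField (p.ResidueField ⊗[R] A))
    [Fintype (simpleClasses R A K)] [Fintype (simpleClasses R A p.ResidueField)] :
    dimJac K (K ⊗[R] A) = dimJac p.ResidueField (p.ResidueField ⊗[R] A) ↔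
      ∑ x : simpleClasses R A K, dim (x : G0 R A K) ^ 2 =
        ∑ y : simpleClasses R A p.ResidueField, dim (y : G0 R A p.ResidueField) ^ 2 := by
  have h1 := finrank_eq_dimJac_add_sum hK
  have h2 := finrank_eq_dimJac_add_sum hp
  rw [Module.finrank_baseChange] at h1 h2
  omega

theorem IsGate.dimJac_eq (hO : O.IsGate A) (hK : IsSplitAlgebra K (K ⊗[R] A))
    (hp : IsSplitAlgebra p.ResidueField (p.ResidueField ⊗[R] A))
    (htriv : O.HasTrivialDecompositionMap A) :
    dimJac K (K ⊗[R] A) = dimJac p.ResidueField (p.ResidueField ⊗[R] A) := by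
  have := Fintype.ofFinite (simpleClasses R A K)
  have := Fintype.ofFinite (simpleClasses R A p.ResidueField)
  rw [dimJac_eq_iff_sum_sq_eq hK hp]
  refine Fintype.sum_equiv (Set.BijOn.equiv _ htriv) _ _ fun x => ?_
  rw [← hO.dim_decompositionMap]
  rfl

theorem IsGate.hasTrivialDecompositionMap (hO : O.IsGate A) (hK : IsSplitAlgebra K (K ⊗[R] A))
    (hp : IsSplitAlgebra p.ResidueField (p.ResidueField ⊗[R] A))
    (hJac : dimJac K (K ⊗[R] A) = dimJac p.ResidueField (p.ResidueField ⊗[R] A)) :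
    O.HasTrivialDecompositionMap A := by
  classical
  have := Fintype.ofFinite (simpleClasses R A K)
  have := Fintype.ofFinite (simpleClasses R A p.ResidueField)
  rw [dimJac_eq_iff_sum_sq_eq hK hp] at hJac
  let d := O.decompositionMap A
  let bK := simpleBasis R A K
  let bp := simpleBasis R A p.ResidueField
  have hsum : ∀ x, d x = ∑ y, bp.repr (d x) y • (y : G0 R A p.ResidueField) := fun x => by
    conv_lhs => rw [← bp.sum_repr (d x)]
    simp only [bp, simpleBasis_apply]
  obtain ⟨σ, hσ, hD⟩ := exists_bijective_of_sum_sq_eq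
    (fun (x : simpleClasses R A K) (y : simpleClasses R A p.ResidueField) => bp.repr (d x) y)
    (fun y => dim (y : G0 R A p.ResidueField)) (fun x => dim (x : G0 R A K))
    (fun x y => by
      rw [← mk_simpleRep x]
      exact hO.repr_decompositionMap_nonneg hp _ y)
    dim_simple_pos dim_simple_pos
    (fun x => by
      rw [← hO.dim_decompositionMap]
      change dim (d x) = _
      conv_lhs => rw [hsum x, map_sum]
      simp only [map_zsmul, smul_eq_mul])
    -- A zero column `y` would make `y` absent from `[A(𝔭)]`, the image of `[A^K]`.
    (fun y => by
      by_contra! h0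
      have h1 := repr_regular_pos (A := A) y
      rw [← hO.decompositionMap_regular, ← bK.sum_repr (G0.mk (FinMod.regular R A K)), map_sum,
        map_sum, Finsupp.finsetSum_apply] at h1
      refine h1.ne' (Finset.sum_eq_zero fun x _ => ?_)
      rw [map_zsmul, map_zsmul, Finsupp.smul_apply, simpleBasis_apply]
      exact (congrArg _ (h0 x)).trans (smul_zero _))
    hJac
  have hd : ∀ x : simpleClasses R A K, d x = σ x := fun x => by
    rw [hsum, Finset.sum_eq_single (σ x)]
    · rw [hD, if_pos rfl, one_smul]
    · intro y _ hy
      rw [hD, if_neg hy.symm, zero_smul]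
    · exact fun h => (h (Finset.mem_univ _)).elim
  refine ⟨fun x hx => ?_, fun x hx x' hx' h => ?_, fun y hy => ?_⟩
  · exact (hd ⟨x, hx⟩).symm ▸ (σ ⟨x, hx⟩).2
  · have h' : σ ⟨x, hx⟩ = σ ⟨x', hx'⟩ :=
      Subtype.ext ((hd ⟨x, hx⟩).symm.trans (h.trans (hd ⟨x', hx'⟩)))
    exact congrArg Subtype.val (hσ.1 h')
  · obtain ⟨x, hx⟩ := hσ.2 ⟨y, hy⟩
    exact ⟨x, x.2, (hd x).trans (congrArg Subtype.val hx)⟩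

end LocalRingOver

end Decomposition

theorem theorem2p2
    (R : Type u) [CommRing R] [IsDomain R] [IsNoetherianRing R]
    (K : Type u) [Field K] [Algebra R K] [IsFractionRing R K]
    (A : Type v) [Ring A] [Algebra R A] [Module.Finite R A] [Module.Free R A]
    (p : Ideal R) [p.IsPrime]
    (hK : Decomposition.IsSplitAlgebra K (TensorProduct R K A))
    (hp : Decomposition.IsSplitAlgebra p.ResidueField (TensorProduct R p.ResidueField A)) :
    (∀ O : Decomposition.LocalRingOver R K p, O.IsGate A →
      ∃! d : Decomposition.G0 R A K →+ Decomposition.G0 R A p.ResidueField,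
        O.IsDecompositionMap d) ∧
    List.TFAE [
      ∃ O : Decomposition.LocalRingOver R K p, O.IsGate A ∧ O.HasTrivialDecompositionMap A,
      ∀ O : Decomposition.LocalRingOver R K p, O.IsGate A → O.HasTrivialDecompositionMap A,
      Decomposition.dimJac K (TensorProduct R K A) =
        Decomposition.dimJac p.ResidueField (TensorProduct R p.ResidueField A)] := by
  refine ⟨fun O hO => hO.existsUnique, ?_⟩
  tfae_have 1 → 3 := fun ⟨O, hO, htriv⟩ => hO.dimJac_eq hK hp htriv
  tfae_have 3 → 2 := fun h O hO => hO.hasTrivialDecompositionMap hK hp h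
  tfae_have 2 → 1 := fun h => by
    obtain ⟨O, hO⟩ := Decomposition.LocalRingOver.exists_isGate (K := K) (A := A) p hp
    exact ⟨O, hO, h O hO⟩
  tfae_finish
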